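/- Let $M\ge 2$ and $0<\underline\lambda<\bar\lambda$. For real gains $\alpha,\beta_1,\dots,\beta_{M-1}$ consider the memory-accelerated iteration in $\mathbb R^N$ $$x(t+1)=x(t)+\alpha\,(b-Ax(t))+\sum_{m=1}^{M-1}\beta_m\,(x(t-m)-x(t)),\qquad t\ge 0,$$ where $A$ is self-adjoint, all its nonzero eigenvalues lie in $[\underline\lambda,\bar\lambda]$, and $As=b$ has a solution $s$. For an eigenvector $v$ of $A$ with eigenvalue $\lambda\neq 0$, the mode $u(t)=\langle v,x(t)-s\rangle$ satisfies the scalar linear difference equation $$u(t+1)=(1-\alpha\lambda)u(t)+\sum_{m=1}^{M-1}\beta_m\,(u(t-m)-u(t)),$$ whose characteristic polynomial is $$P(z;\lambda)=z^M-(1-\alpha\lambda)z^{M-1}+\sum_{m=1}^{M-1}\beta_m\,(z^{M-1}-z^{M-1-m}).$$ Define the convergence speed guarantee $$\nu(\alpha,\beta_1,\dots,\beta_{M-1})=\max\{|z| : z\in\mathbb C,\ P(z;\lambda)=0 \text{ for some } \lambda\in[\underline\lambda,\bar\lambda]\}$$ (the maximum is attained, and it bounds the modulus of every characteristic root of every mode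 of $A$ with nonzero eigenvalue). Put $\mu=(\bar\lambda-\underline\lambda)/(\bar\lambda+\underline\lambda)$. **Theorem 3.** The guarantee $\nu$ is minimized over all $\alpha,\beta_1,\dots,\beta_{M-1}\in\mathbb R$ by using a single memory slot: $$\beta_m=0\ (m>1),\qquad \beta_1=\beta_{1*}=-\Big(\tfrac1\mu-\sqrt{\tfrac1{\mu^2}-1}\Big)^2,\qquad \alpha=\alpha_*=\frac{2(1-\beta_{1*})}{\bar\lambda+\underline\lambda}.$$ The minimal value is $\nu_*=\frac1\mu-\sqrt{\frac1{\mu^2}-1}=\sqrt{-\beta_{1*}}$, and it lies in $(0,1)$. Moreover, the following equivalent statement (Claim 6) holds: for every $\nu\in(0,1)$ and every real polynomial $\tilde P_{M-1}(y)=\sum_{k=0}^{M-1}a_ky^k$ with $a_{M-1}\ne-1$, there is $\theta\in[0,\pi]$ such that $$(y-e^{i\theta})(y-e^{-i\theta})\,y^{M-2}+\big(y-\tfrac1\nu\big)\tilde P_{M-1}(y)$$ has a root $y\in\mathbb C$ with $|y|\ge1$. -/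

import Mathlib

open Polynomial

/-- The memory-accelerated iteration
`x(t+1) = x(t) + α (b - A x(t)) + ∑_{m=1}^{M-1} β_m (x(t-m) - x(t))` for all times `t ≥ 0`,
in `ℝ^N`; the values `x(0), x(-1), …, x(-(M-1))` are the initial data. -/
def IsMemoryTrajectory {N : ℕ} (M : ℕ)
    (A : EuclideanSpace ℝ (Fin N) →ₗ[ℝ] EuclideanSpace ℝ (Fin N))
    (b : EuclideanSpace ℝ (Fin N)) (α : ℝ) (β : ℕ → ℝ)
    (x : ℤ → EuclideanSpace ℝ (Fin N)) : Prop :=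
  ∀ t : ℤ, 0 ≤ t →
    x (t + 1) = x t + α • (b - A (x t))
      + ∑ m ∈ Finset.Icc 1 (M - 1), β m • (x (t - (m : ℤ)) - x t)

/-- The scalar linear difference equation of a mode with eigenvalue `lam` (homogeneous part),
`u(t+1) = (1 - α lam) u(t) + ∑_{m=1}^{M-1} β_m (u(t-m) - u(t))`, as a recurrence of order `M`:
the coefficient of `u(t)` is `1 - α lam - ∑ β_m`, and that of `u(t-m)` is `β_m`. The index `i`
of a coefficient stands for the delay `m = M - 1 - i`. -/
noncomputable def modalRecurrence (M : ℕ) (α : ℝ) (β : ℕ → ℝ) (lam : ℝ) :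
    LinearRecurrence ℝ where
  order := M
  coeffs := fun i =>
    if (i : ℕ) + 1 = M then 1 - α * lam - ∑ m ∈ Finset.Icc 1 (M - 1), β m
    else β (M - 1 - (i : ℕ))

/-- `z` is a complex root of the characteristic polynomial of the modal recurrence. -/
def IsModalRoot (M : ℕ) (α : ℝ) (β : ℕ → ℝ) (lam : ℝ) (z : ℂ) : Prop :=
  ((modalRecurrence M α β lam).charPoly.map (algebraMap ℝ ℂ)).IsRoot z

/-- The moduli of all characteristic roots, for all `lam ∈ [lo, hi]`. -/
def rootModuli (M : ℕ) (lo hi α : ℝ) (β : ℕ → ℝ) : Set ℝ :=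
  {r | ∃ lam ∈ Set.Icc lo hi, ∃ z : ℂ, IsModalRoot M α β lam z ∧ r = ‖z‖}

/-- The convergence speed guarantee: the largest modulus of a characteristic root over all
`lam ∈ [lo, hi]`. -/
noncomputable def speedGuarantee (M : ℕ) (lo hi α : ℝ) (β : ℕ → ℝ) : ℝ :=
  sSup (rootModuli M lo hi α β)

/-- `μ = (hi - lo) / (hi + lo)`. -/
noncomputable def muOf (lo hi : ℝ) : ℝ := (hi - lo) / (hi + lo)

/-- `ν⋆ = 1/μ - √(1/μ² - 1)`. -/
noncomputable def nuStar (lo hi : ℝ) : ℝ :=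
  1 / muOf lo hi - √(1 / muOf lo hi ^ 2 - 1)

/-- `β₁⋆ = -(1/μ - √(1/μ² - 1))²`. -/
noncomputable def betaOneStar (lo hi : ℝ) : ℝ :=
  -(1 / muOf lo hi - √(1 / muOf lo hi ^ 2 - 1)) ^ 2

/-- `α⋆ = 2 (1 - β₁⋆) / (hi + lo)`. -/
noncomputable def alphaStar (lo hi : ℝ) : ℝ := 2 * (1 - betaOneStar lo hi) / (hi + lo)

/-- The gains with a single memory slot: `β₁ = β₁⋆` and `β_m = 0` for all `m > 1`. -/
noncomputable def betaStar (lo hi : ℝ) : ℕ → ℝ :=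
  fun m => if m = 1 then betaOneStar lo hi else 0

/-! The lower bound on the guarantee is a Schwarz lemma in disguise. Substitute `z = 1 / w` and
clear denominators: with `λ₀` the midpoint of the spectral interval and `δ` half its length, the
characteristic polynomial for `λ = λ₀ - c δ`, `c ∈ [-1, 1]`, becomes `D(w) - c α δ w`, where `D` is
a polynomial with `D(0) = 1`. If all roots had modulus below `ν⋆`, these functions would not vanish
on the closed disk `|w| ≤ 1 / ν⋆`, so that `k(w) = α δ w / D(w)` would avoid the real rays
`(-∞, -1]` and `[1, ∞)` there. The map `joukowskyInv` sends the complement of these rays to the unit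
disk, hence `joukowskyInv ∘ k` maps the closed disk of radius `1 / ν⋆` to the open unit disk and
fixes `0`, and the Schwarz lemma gives `|joukowskyInv (k 1)| < ν⋆`. But `k 1` does not depend on the
gains: differences `x(t-m) - x(t)` vanish on constants, so `D 1 = α λ₀` and `k 1 = δ / λ₀ = μ`, whose
image is exactly `ν⋆`. (For `α = 0` the point `w = 1` is a zero of `D`; the lemma takes the
value of `k` in the form `α δ = μ D 1`, which covers this case.) The step shared by both
applications is `inv_joukowsky_lt_div_of_forall_ne`.

The polynomial statement is the same argument on the unit disk: there
`k(w) = 2 w / (1 + w² + (1 - w / ν) S(w))` with `S` the reciprocal of the given polynomial, so that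
`k ν = 2 ν / (1 + ν²)`, which `joukowskyInv` sends to `ν`; the Schwarz lemma would give `ν < ν`. The
condition `a_{M-1} ≠ -1` is what keeps the denominator nonzero at `w = 0`.

For the single-slot gains the characteristic polynomial is `z ^ (M - 2) (z² - 2 ν⋆ c z + ν⋆²)` with
`c ∈ [-1, 1]`, whose nonzero roots have modulus `ν⋆`. The maximum is attained since the pairs of
an eigenvalue and a root form a compact set.
-/

/-! ### The inverse Joukowsky map and the Schwarz lemma -/

/-- The inverse of `ζ ↦ 2ζ / (1 + ζ²)`, from the plane without the real rays `(-∞, -1]` and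
`[1, ∞)` onto the unit disk. In terms of `h = 2 / k` it is the branch in the unit disk of the
inverse of the Joukowsky map `ζ ↦ ζ + ζ⁻¹ = h`. The square root is the principal one. -/
noncomputable def joukowskyInv (k : ℂ) : ℂ := k / (1 + (1 - k ^ 2) ^ (2⁻¹ : ℂ))

lemma re_cpow_inv_two_pos {x : ℂ} (hx : x ∈ Complex.slitPlane) :
    0 < (x ^ (2⁻¹ : ℂ)).re := by
  rw [Complex.cpow_inv_two_re]
  apply Real.sqrt_pos.2
  rcases Complex.mem_slitPlane_iff.1 hx with h | h
  · have := norm_nonneg x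
    linarith
  · have := Complex.abs_re_lt_norm.2 h
    have := neg_abs_le x.re
    linarith

lemma one_add_cpow_inv_two_ne_zero {x : ℂ} (hx : x ∈ Complex.slitPlane) :
    1 + x ^ (2⁻¹ : ℂ) ≠ 0 := by
  intro h
  have h1 := re_cpow_inv_two_pos hx
  have h2 := congrArg Complex.re h
  simp only [Complex.add_re, Complex.one_re, Complex.zero_re] at h2
  linarith

lemma one_sub_sq_mem_slitPlane {k : ℂ} (h : ∀ c ∈ Set.Icc (-1 : ℝ) 1, (c : ℂ) * k ≠ 1) :
    1 - k ^ 2 ∈ Complex.slitPlane := by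
  by_contra hk
  rw [Complex.mem_slitPlane_iff] at hk
  push Not at hk
  obtain ⟨h1, h2⟩ := hk
  simp only [pow_two, Complex.sub_re, Complex.one_re, Complex.mul_re, Complex.sub_im,
    Complex.one_im, Complex.mul_im] at h1 h2
  have him : k.im = 0 := by
    have : k.re * k.im = 0 := by linarith
    rcases mul_eq_zero.1 this with h0 | h0
    · rw [h0] at h1
      nlinarith [sq_nonneg k.im]
    · exact h0
  rw [him] at h1
  have hre : 1 ≤ |k.re| := by
    rw [← Real.sqrt_sq_eq_abs]
    exact Real.one_le_sqrt.2 (by nlinarith)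
  have hne : k.re ≠ 0 := fun h0 => by norm_num [h0] at hre
  have hk : k = (k.re : ℂ) := Complex.ext (by simp) (by simpa using him)
  refine h k.re⁻¹ (abs_le.1 ?_) ?_
  · rw [abs_inv]
    exact inv_le_one_of_one_le₀ hre
  · rw [hk, Complex.ofReal_re, ← Complex.ofReal_mul, inv_mul_cancel₀ hne, Complex.ofReal_one]

lemma norm_joukowskyInv_lt_one {k : ℂ} (hk : 1 - k ^ 2 ∈ Complex.slitPlane) :
    ‖joukowskyInv k‖ < 1 := by
  have hre := re_cpow_inv_two_pos hk
  have hs : ((1 - k ^ 2) ^ (2⁻¹ : ℂ)) ^ 2 = 1 - k ^ 2 := by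
    simpa only [Nat.cast_ofNat] using Complex.cpow_nat_inv_pow (1 - k ^ 2) two_ne_zero
  have hne := one_add_cpow_inv_two_ne_zero hk
  unfold joukowskyInv
  set s := (1 - k ^ 2) ^ (2⁻¹ : ℂ)
  rw [norm_div, div_lt_one (norm_pos_iff.2 hne)]
  -- `‖k‖² = ‖1 - s‖ ‖1 + s‖`, and `s` lies in the right half-plane
  have h1 : ‖k‖ ^ 2 = ‖1 - s‖ * ‖1 + s‖ := by
    rw [← norm_pow, ← norm_mul]
    congr 1
    linear_combination hs
  have h2 : ‖1 - s‖ < ‖1 + s‖ := by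
    apply lt_of_pow_lt_pow_left₀ 2 (norm_nonneg _)
    rw [Complex.sq_norm, Complex.sq_norm, Complex.normSq_apply, Complex.normSq_apply]
    simp only [Complex.sub_re, Complex.sub_im, Complex.add_re, Complex.add_im, Complex.one_re,
      Complex.one_im]
    nlinarith
  apply lt_of_pow_lt_pow_left₀ 2 (norm_nonneg _)
  rw [h1, pow_two]
  exact mul_lt_mul_of_pos_right h2 (norm_pos_iff.2 hne)

lemma joukowskyInv_ofReal {μ : ℝ} (hμ : μ ^ 2 ≤ 1) :
    joukowskyInv μ = ((μ / (1 + √(1 - μ ^ 2)) : ℝ) : ℂ) := by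
  unfold joukowskyInv
  have h : (1 - (μ : ℂ) ^ 2) ^ (2⁻¹ : ℂ) = ((√(1 - μ ^ 2) : ℝ) : ℂ) := by
    rw [Real.sqrt_eq_rpow, Complex.ofReal_cpow (by linarith)]
    push_cast
    norm_num
  rw [h]
  push_cast
  rfl

lemma differentiableAt_joukowskyInv {k : ℂ} (hk : 1 - k ^ 2 ∈ Complex.slitPlane) :
    DifferentiableAt ℂ joukowskyInv k := by
  unfold joukowskyInv
  refine DifferentiableAt.div differentiableAt_id ?_ (one_add_cpow_inv_two_ne_zero hk)
  refine (differentiableAt_const _).add (DifferentiableAt.cpow_const ?_ hk)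
  fun_prop

/-- The analytic core: if the entire function `D` differs from `c B w` for all `c ∈ [-1, 1]` on
the disk of radius `R`, then `k = B w / D` avoids the two real rays, and the Schwarz lemma for
`joukowskyInv ∘ k` bounds the value of `k` at a point `x` of the disk. The bound is strict because
the hypothesis covers the closed disk. -/
lemma inv_joukowsky_lt_div_of_forall_ne {D : ℂ → ℂ} (hD : Differentiable ℂ D) {B R x μ : ℝ}
    (hx : 0 < x) (hxR : x < R) (hμ : μ ^ 2 ≤ 1)
    (h : ∀ c ∈ Set.Icc (-1 : ℝ) 1, ∀ w : ℂ, ‖w‖ ≤ R → D w ≠ c * B * w)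
    (hval : (B : ℂ) * x = μ * D x) :
    μ / (1 + √(1 - μ ^ 2)) < x / R := by
  have hD0 : ∀ w : ℂ, ‖w‖ ≤ R → D w ≠ 0 := fun w hw => by
    simpa using h 0 (by norm_num) w hw
  let k : ℂ → ℂ := fun w => B * w / D w
  have hslit : ∀ w : ℂ, ‖w‖ ≤ R → 1 - k w ^ 2 ∈ Complex.slitPlane := fun w hw => by
    refine one_sub_sq_mem_slitPlane fun c hc heq => h c hc w hw ?_
    have := hD0 w hw
    simp only [k] at heq
    field_simp at heq
    linear_combination -heq
  let g : ℂ → ℂ := fun w => joukowskyInv (k w)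
  have hdiff : ∀ w : ℂ, ‖w‖ ≤ R → DifferentiableAt ℂ g w := fun w hw => by
    refine DifferentiableAt.comp (f := k) w (differentiableAt_joukowskyInv (hslit w hw)) ?_
    exact DifferentiableAt.div (by fun_prop) (hD w) (hD0 w hw)
  have hg0 : g 0 = 0 := by simp [g, k, joukowskyInv]
  have hR : 0 < R := hx.trans hxR
  -- a bound `r < 1` for `g`, by compactness of the closed disk
  obtain ⟨w₀, hw₀, hmax⟩ := (isCompact_closedBall (0 : ℂ) R).exists_isMaxOn
    ⟨0, Metric.mem_closedBall_self hR.le⟩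
    (f := fun w => ‖g w‖)
    (fun w hw => (hdiff w (by simpa using hw)).continuousAt.norm.continuousWithinAt)
  have hr : ‖g w₀‖ < 1 := norm_joukowskyInv_lt_one (hslit w₀ (by simpa using hw₀))
  have hS := Complex.dist_le_div_mul_dist_of_mapsTo_ball (f := g) (c := 0) (R₁ := R)
    (R₂ := ‖g w₀‖) (z := (x : ℂ))
    (fun w hw => (hdiff w (by simpa using (Metric.ball_subset_closedBall hw))).differentiableWithinAt)
    (fun w hw => by
      rw [hg0]
      simpa using hmax (Metric.ball_subset_closedBall hw))
    (by simpa [abs_of_pos hx] using hxR)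
  have hxle : ‖(x : ℂ)‖ ≤ R := by simpa [abs_of_pos hx] using hxR.le
  have hgx : g x = ((μ / (1 + √(1 - μ ^ 2)) : ℝ) : ℂ) := by
    rw [← joukowskyInv_ofReal hμ]
    simp only [g, k]
    rw [hval, mul_div_cancel_right₀ _ (hD0 x hxle)]
  rw [hg0, dist_zero_right, dist_zero_right, hgx, Complex.norm_real, Complex.norm_real,
    Real.norm_eq_abs, Real.norm_eq_abs, abs_of_pos hx] at hS
  calc _ ≤ _ := le_abs_self _
    _ ≤ _ := hS
    _ = ‖g w₀‖ * (x / R) := by ring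
    _ < x / R := mul_lt_of_lt_one_left (div_pos hx hR) hr

/-! ### Characteristic roots of the modal recurrence -/

lemma sum_modalRecurrence_coeffs_smul {E : Type*} [AddCommGroup E] [Module ℝ E] {M : ℕ}
    (hM : 1 ≤ M) (α : ℝ) (β : ℕ → ℝ) (lam : ℝ) (f : ℕ → E) :
    ∑ i : Fin M, (modalRecurrence M α β lam).coeffs i • f i =
      (1 - α * lam - ∑ m ∈ Finset.Icc 1 (M - 1), β m) • f (M - 1)
        + ∑ m ∈ Finset.Icc 1 (M - 1), β m • f (M - 1 - m) := by
  obtain ⟨K, rfl⟩ : ∃ K, M = K + 1 := ⟨M - 1, by omega⟩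
  simp only [modalRecurrence, Nat.add_sub_cancel]
  set S := 1 - α * lam - ∑ m ∈ Finset.Icc 1 K, β m
  rw [Fin.sum_univ_eq_sum_range
    (fun i => (if i + 1 = K + 1 then S else β (K - i)) • f i) (K + 1), ← Finset.sum_range_reflect,
    Finset.sum_range_succ', add_comm]
  congr 1
  · simp
  · have hI : Finset.Icc 1 K = Finset.Ico (0 + 1) (K + 1) := rfl
    rw [hI, ← Finset.sum_Ico_add' (fun m => β m • f (K - m)), ← Finset.range_eq_Ico]
    refine Finset.sum_congr rfl fun j hj => ?_
    have hj := Finset.mem_range.1 hj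
    have e1 : K + 1 - 1 - (j + 1) = K - (j + 1) := by omega
    have e2 : K - (K - (j + 1)) = j + 1 := by omega
    rw [e1, e2, if_neg (by omega)]

lemma isModalRoot_iff_sum {M : ℕ} {α : ℝ} {β : ℕ → ℝ} {lam : ℝ} {z : ℂ} :
    IsModalRoot M α β lam z ↔
      z ^ M = ∑ i : Fin M, (modalRecurrence M α β lam).coeffs i • z ^ (i : ℕ) := by
  have h : (modalRecurrence M α β lam).order = M := rfl
  rw [IsModalRoot, LinearRecurrence.charPoly, Polynomial.IsRoot, Polynomial.map_sub,
    Polynomial.eval_sub, sub_eq_zero]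
  simp only [Polynomial.map_sum, Polynomial.eval_finsetSum, Polynomial.map_monomial,
    Polynomial.eval_monomial, map_one, one_mul, h, Complex.real_smul]
  rfl

lemma isModalRoot_iff {M : ℕ} (hM : 1 ≤ M) {α : ℝ} {β : ℕ → ℝ} {lam : ℝ} {z : ℂ} :
    IsModalRoot M α β lam z ↔
      z ^ M = ((1 - α * lam - ∑ m ∈ Finset.Icc 1 (M - 1), β m : ℝ) : ℂ) * z ^ (M - 1)
        + ∑ m ∈ Finset.Icc 1 (M - 1), (β m : ℂ) * z ^ (M - 1 - m) := by
  rw [isModalRoot_iff_sum,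
    sum_modalRecurrence_coeffs_smul hM α β lam (fun i => z ^ i)]
  simp only [Complex.real_smul]

lemma exists_isModalRoot {M : ℕ} (hM : 1 ≤ M) (α : ℝ) (β : ℕ → ℝ) (lam : ℝ) :
    ∃ z : ℂ, IsModalRoot M α β lam z := by
  apply IsAlgClosed.exists_root
  rw [Polynomial.degree_map, LinearRecurrence.charPoly_degree_eq_order]
  change (M : WithBot ℕ) ≠ 0
  exact_mod_cast (by omega : M ≠ 0)

/-! ### The maximum is attained -/

/-- Cauchy's bound for the roots of a monic polynomial. -/
lemma norm_le_one_add_sum_of_pow_eq {M : ℕ} {c : Fin M → ℝ} {z : ℂ}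
    (h : z ^ M = ∑ i : Fin M, c i • z ^ (i : ℕ)) : ‖z‖ ≤ 1 + ∑ i, |c i| := by
  have hS : 0 ≤ ∑ i, |c i| := Finset.sum_nonneg fun i _ => abs_nonneg _
  rcases le_total ‖z‖ 1 with h1 | h1
  · linarith
  have hM : M ≠ 0 := by
    rintro rfl
    simp at h
  have h2 : ‖z‖ * ‖z‖ ^ (M - 1) ≤ (∑ i, |c i|) * ‖z‖ ^ (M - 1) := by
    rw [← pow_succ', Nat.sub_add_cancel (Nat.one_le_iff_ne_zero.2 hM), ← norm_pow, h,
      Finset.sum_mul]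
    refine norm_sum_le_of_le _ fun i _ => ?_
    rw [norm_smul, norm_pow, Real.norm_eq_abs]
    exact mul_le_mul_of_nonneg_left (pow_le_pow_right₀ h1 (by omega)) (abs_nonneg _)
  have := le_of_mul_le_mul_right h2 (by positivity)
  linarith

lemma continuous_modalRecurrence_coeffs (M : ℕ) (α : ℝ) (β : ℕ → ℝ) (i : Fin M) :
    Continuous fun lam : ℝ => (modalRecurrence M α β lam).coeffs i := by
  simp only [modalRecurrence]
  split_ifs <;> fun_prop

lemma isCompact_rootModuli (M : ℕ) (lo hi α : ℝ) (β : ℕ → ℝ) :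
    IsCompact (rootModuli M lo hi α β) := by
  have hcont := continuous_modalRecurrence_coeffs M α β
  obtain ⟨C, hC⟩ := (isCompact_Icc (a := lo) (b := hi)).exists_bound_of_continuousOn
    (f := fun lam => 1 + ∑ i : Fin M, |(modalRecurrence M α β lam).coeffs i|)
    (continuous_const.add (continuous_finsetSum _ fun i _ => (hcont i).abs)).continuousOn
  let T : Set (ℝ × ℂ) := {p | IsModalRoot M α β p.1 p.2}
  have hT : IsClosed T := by
    simp only [T, isModalRoot_iff_sum]
    refine isClosed_eq (by fun_prop) (continuous_finsetSum _ fun i _ => ?_)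
    exact ((hcont i).comp continuous_fst).smul (by fun_prop)
  have hK : IsCompact ((Set.Icc lo hi ×ˢ Metric.closedBall (0 : ℂ) C) ∩ T) :=
    (isCompact_Icc.prod (isCompact_closedBall _ _)).inter_right hT
  convert hK.image (f := fun p : ℝ × ℂ => ‖p.2‖) (by fun_prop) using 1
  ext r
  constructor
  · rintro ⟨lam, hlam, z, hz, rfl⟩
    refine ⟨(lam, z), ⟨⟨hlam, ?_⟩, hz⟩, rfl⟩
    have h1 := norm_le_one_add_sum_of_pow_eq (isModalRoot_iff_sum.1 hz)
    have h2 := (le_abs_self _).trans (hC lam hlam)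
    simpa using h1.trans h2
  · rintro ⟨⟨lam, z⟩, ⟨⟨hlam, -⟩, hz⟩, rfl⟩
    exact ⟨lam, hlam, z, hz, rfl⟩

lemma isGreatest_speedGuarantee {M : ℕ} (hM : 1 ≤ M) {lo hi : ℝ} (hlohi : lo ≤ hi) (α : ℝ)
    (β : ℕ → ℝ) : IsGreatest (rootModuli M lo hi α β) (speedGuarantee M lo hi α β) := by
  obtain ⟨z, hz⟩ := exists_isModalRoot hM α β lo
  exact (isCompact_rootModuli M lo hi α β).isGreatest_sSup
    ⟨‖z‖, lo, Set.left_mem_Icc.2 hlohi, z, hz, rfl⟩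

/-! ### The modes of the iteration -/

lemma isSolution_mode {N M : ℕ} (hM : 1 ≤ M)
    {A : EuclideanSpace ℝ (Fin N) →ₗ[ℝ] EuclideanSpace ℝ (Fin N)}
    {b : EuclideanSpace ℝ (Fin N)} (hA : A.IsSymmetric) {α : ℝ} {β : ℕ → ℝ}
    {x : ℤ → EuclideanSpace ℝ (Fin N)} (hx : IsMemoryTrajectory M A b α β x)
    {s : EuclideanSpace ℝ (Fin N)} (hs : A s = b) {lam : ℝ} {v : EuclideanSpace ℝ (Fin N)}
    (hv : A v = lam • v) :
    (modalRecurrence M α β lam).IsSolution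
      (fun n : ℕ => inner ℝ v (x ((n : ℤ) - ((M : ℤ) - 1)) - s)) := by
  intro n
  have hsum := sum_modalRecurrence_coeffs_smul hM α β lam
    (fun i => inner ℝ v (x (((n + i : ℕ) : ℤ) - ((M : ℤ) - 1)) - s))
  simp only [smul_eq_mul] at hsum
  refine Eq.trans ?_ hsum.symm
  have hord : (modalRecurrence M α β lam).order = M := rfl
  have e0 : (((n + M : ℕ) : ℤ) - ((M : ℤ) - 1)) = (n : ℤ) + 1 := by push_cast; ring
  have e1 : (((n + (M - 1) : ℕ) : ℤ) - ((M : ℤ) - 1)) = (n : ℤ) := by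
    push_cast [Nat.cast_sub hM]; ring
  have e2 : ∀ m ∈ Finset.Icc 1 (M - 1),
      β m * inner ℝ v (x (((n + (M - 1 - m) : ℕ) : ℤ) - ((M : ℤ) - 1)) - s) =
        β m * inner ℝ v (x ((n : ℤ) - m)) - β m * inner ℝ v s := fun m hm => by
    have hm := (Finset.mem_Icc.1 hm).2
    have : (((n + (M - 1 - m) : ℕ) : ℤ) - ((M : ℤ) - 1)) = (n : ℤ) - m := by
      push_cast [Nat.cast_sub hM, Nat.cast_sub hm]; ring
    rw [this, inner_sub_right, mul_sub]
  have hAx : ∀ y, inner ℝ v (A y) = lam * inner ℝ v y := fun y => by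
    rw [← hA v y, hv, real_inner_smul_left]
  beta_reduce
  rw [Finset.sum_congr rfl e2, hord, e0, e1, hx n (Int.natCast_nonneg n), ← hs]
  simp only [inner_sub_right, inner_add_right, inner_smul_right, inner_sum, hAx, mul_sub,
    Finset.sum_sub_distrib, ← Finset.sum_mul]
  ring

/-! ### The optimal value -/

lemma muOf_mem_Ioo {lo hi : ℝ} (hlo : 0 < lo) (hlohi : lo < hi) :
    muOf lo hi ∈ Set.Ioo (0 : ℝ) 1 := by
  unfold muOf
  exact ⟨div_pos (by linarith) (by linarith), (div_lt_one (by linarith)).2 (by linarith)⟩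

lemma nuStar_eq {lo hi : ℝ} (hlo : 0 < lo) (hlohi : lo < hi) :
    nuStar lo hi = muOf lo hi / (1 + √(1 - muOf lo hi ^ 2)) := by
  obtain ⟨h0, h1⟩ := muOf_mem_Ioo hlo hlohi
  unfold nuStar
  set μ := muOf lo hi
  have hs : √(1 / μ ^ 2 - 1) = √(1 - μ ^ 2) / μ := by
    rw [show 1 / μ ^ 2 - 1 = (1 - μ ^ 2) / μ ^ 2 by field_simp, Real.sqrt_div' _ (by positivity),
      Real.sqrt_sq h0.le]
  have hsq : √(1 - μ ^ 2) ^ 2 = 1 - μ ^ 2 := Real.sq_sqrt (by nlinarith)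
  rw [hs]
  have : 0 ≤ √(1 - μ ^ 2) := Real.sqrt_nonneg _
  field_simp
  linear_combination -hsq

lemma nuStar_mem_Ioo {lo hi : ℝ} (hlo : 0 < lo) (hlohi : lo < hi) :
    nuStar lo hi ∈ Set.Ioo (0 : ℝ) 1 := by
  obtain ⟨h0, h1⟩ := muOf_mem_Ioo hlo hlohi
  rw [nuStar_eq hlo hlohi]
  have : 0 ≤ √(1 - muOf lo hi ^ 2) := Real.sqrt_nonneg _
  exact ⟨by positivity, (div_lt_one (by positivity)).2 (by linarith)⟩

lemma one_add_nuStar_sq_mul_muOf {lo hi : ℝ} (hlo : 0 < lo) (hlohi : lo < hi) :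
    (1 + nuStar lo hi ^ 2) * muOf lo hi = 2 * nuStar lo hi := by
  obtain ⟨h0, h1⟩ := muOf_mem_Ioo hlo hlohi
  rw [nuStar_eq hlo hlohi]
  have hsq : √(1 - muOf lo hi ^ 2) ^ 2 = 1 - muOf lo hi ^ 2 := Real.sq_sqrt (by nlinarith)
  have : 0 ≤ √(1 - muOf lo hi ^ 2) := Real.sqrt_nonneg _
  field_simp
  linear_combination hsq

/-! ### The lower bound for arbitrary gains -/

lemma nuStar_le_speedGuarantee {M : ℕ} (hM : 1 ≤ M) {lo hi : ℝ} (hlo : 0 < lo) (hlohi : lo < hi)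
    (α : ℝ) (β : ℕ → ℝ) : nuStar lo hi ≤ speedGuarantee M lo hi α β := by
  by_contra! hlt
  obtain ⟨hν0, hν1⟩ := nuStar_mem_Ioo hlo hlohi
  obtain ⟨hμ0, hμ1⟩ := muOf_mem_Ioo hlo hlohi
  have hroot : ∀ lam ∈ Set.Icc lo hi, ∀ z, IsModalRoot M α β lam z → ‖z‖ < nuStar lo hi :=
    fun lam hlam z hz => ((isGreatest_speedGuarantee hM hlohi.le α β).2
      ⟨lam, hlam, z, hz, rfl⟩).trans_lt hlt
  -- the reciprocal polynomial for the midpoint of the spectral interval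
  let D : ℂ → ℂ := fun w =>
    1 - ((1 - α * ((lo + hi) / 2) - ∑ m ∈ Finset.Icc 1 (M - 1), β m : ℝ) : ℂ) * w
      - ∑ m ∈ Finset.Icc 1 (M - 1), (β m : ℂ) * w ^ (m + 1)
  have hD : Differentiable ℂ D := by fun_prop
  have key := inv_joukowsky_lt_div_of_forall_ne hD (B := α * ((hi - lo) / 2))
    (R := 1 / nuStar lo hi) (x := 1) (μ := muOf lo hi) one_pos
    ((one_lt_div hν0).2 hν1) (by nlinarith) ?_ ?_
  · rw [← nuStar_eq hlo hlohi, one_div_one_div] at key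
    exact lt_irrefl _ key
  · intro c hc w hw heq
    have hw0 : w ≠ 0 := by
      rintro rfl
      simp [D] at heq
    have hlam : (lo + hi) / 2 - c * ((hi - lo) / 2) ∈ Set.Icc lo hi := by
      constructor <;> nlinarith [hc.1, hc.2]
    have hz : IsModalRoot M α β ((lo + hi) / 2 - c * ((hi - lo) / 2)) w⁻¹ := by
      rw [isModalRoot_iff hM]
      have hp : ∀ m ∈ Finset.Icc 1 (M - 1),
          (β m : ℂ) * w⁻¹ ^ (M - 1 - m) = (β m : ℂ) * w ^ (m + 1) * w⁻¹ ^ M := fun m hm => by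
        have hm := (Finset.mem_Icc.1 hm).2
        rw [show w⁻¹ ^ M = w⁻¹ ^ (M - 1 - m) * w⁻¹ ^ (m + 1) by
          rw [← pow_add]; congr 1; omega, inv_pow w (m + 1)]
        field_simp
      have hp1 : w⁻¹ ^ (M - 1) = w * w⁻¹ ^ M := by
        rw [show w⁻¹ ^ M = w⁻¹ ^ (M - 1) * w⁻¹ by rw [← pow_succ]; congr 1; omega]
        field_simp
      rw [Finset.sum_congr rfl hp, ← Finset.sum_mul, hp1]
      simp only [D] at heq
      push_cast at heq ⊢
      linear_combination w⁻¹ ^ M * heq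
    have hlt' := hroot _ hlam _ hz
    rw [norm_inv] at hlt'
    have hwpos := norm_pos_iff.2 hw0
    rw [le_div_iff₀ hν0] at hw
    rw [inv_lt_iff_one_lt_mul₀ hwpos] at hlt'
    linarith
  · simp only [D, muOf]
    have : (hi + lo : ℂ) ≠ 0 := by exact_mod_cast (by linarith : hi + lo ≠ 0)
    push_cast
    simp only [one_pow, mul_one]
    field_simp
    ring

/-! ### The single-slot tuning -/

/-- The roots of `z² - 2νc z + ν²` with `|c| ≤ 1` have modulus `ν`. -/
lemma norm_eq_of_quadratic {ν c : ℝ} (hν : 0 ≤ ν) (hc : c ∈ Set.Icc (-1 : ℝ) 1) {z : ℂ}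
    (hz : z ^ 2 - 2 * ν * c * z + ν ^ 2 = 0) : ‖z‖ = ν := by
  have hre := congrArg Complex.re hz
  have him := congrArg Complex.im hz
  simp [pow_two] at hre him
  have hn : ‖z‖ ^ 2 = ν ^ 2 := by
    rw [Complex.sq_norm, Complex.normSq_apply]
    by_cases hy : z.im = 0
    · rw [hy] at hre ⊢
      have h1 : 0 ≤ 1 - c ^ 2 := by nlinarith [hc.1, hc.2]
      have h2 : (z.re - ν * c) ^ 2 + ν ^ 2 * (1 - c ^ 2) = 0 := by linarith
      have h3 : 0 ≤ ν ^ 2 * (1 - c ^ 2) := by positivity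
      have h4 : z.re - ν * c = 0 := by
        apply pow_eq_zero_iff two_ne_zero |>.1
        nlinarith [sq_nonneg (z.re - ν * c)]
      nlinarith
    · have hx : z.re = ν * c := by
        apply mul_left_cancel₀ hy
        linarith
      rw [hx] at hre ⊢
      nlinarith
  exact (pow_left_inj₀ (norm_nonneg _) hν two_ne_zero).1 hn

lemma speedGuarantee_star_le {M : ℕ} (hM : 2 ≤ M) {lo hi : ℝ} (hlo : 0 < lo) (hlohi : lo < hi) :
    speedGuarantee M lo hi (alphaStar lo hi) (betaStar lo hi) ≤ nuStar lo hi := by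
  obtain ⟨hν0, hν1⟩ := nuStar_mem_Ioo hlo hlohi
  have hνμ := one_add_nuStar_sq_mul_muOf hlo hlohi
  have hβ : betaOneStar lo hi = -nuStar lo hi ^ 2 := rfl
  obtain ⟨lam, hlam, z, hz, hr⟩ :=
    (isGreatest_speedGuarantee (by omega : 1 ≤ M) hlohi.le (alphaStar lo hi) (betaStar lo hi)).1
  rw [hr]
  have h1 : 1 ∈ Finset.Icc 1 (M - 1) := Finset.mem_Icc.2 ⟨le_rfl, by omega⟩
  rw [isModalRoot_iff (by omega)] at hz
  simp only [betaStar, Complex.ofReal_sub, apply_ite Complex.ofReal,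
    Complex.ofReal_zero, ite_mul, zero_mul, Finset.sum_ite_eq', h1, if_true] at hz
  -- `z` is a root of the quadratic factor, or the root `0` of the factor `z ^ (M - 2)`
  have hsum : hi + lo ≠ 0 := by linarith
  have hd : hi - lo ≠ 0 := by linarith
  let c : ℝ := (hi + lo - 2 * lam) / (hi - lo)
  have hc : c ∈ Set.Icc (-1 : ℝ) 1 := by
    have : 0 < hi - lo := by linarith
    constructor
    · rw [le_div_iff₀ this]; linarith [hlam.2]
    · rw [div_le_iff₀ this]; linarith [hlam.1]
  have hcoef : 1 - alphaStar lo hi * lam - betaOneStar lo hi = 2 * nuStar lo hi * c := by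
    rw [← hνμ, alphaStar, hβ]
    simp only [c, muOf]
    field_simp
    ring
  have hcoefC : (1 : ℂ) - (alphaStar lo hi * lam : ℝ) - betaOneStar lo hi
      = 2 * nuStar lo hi * c := by exact_mod_cast hcoef
  have hfac : z ^ (M - 2) * (z ^ 2 - 2 * nuStar lo hi * c * z + nuStar lo hi ^ 2) = 0 := by
    obtain ⟨K, rfl⟩ : ∃ K, M = K + 2 := ⟨M - 2, by omega⟩
    rw [show K + 2 - 1 = K + 1 by omega, show K + 1 - 1 = K by omega, Complex.ofReal_one, hcoefC,
      hβ] at hz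
    rw [show K + 2 - 2 = K by omega]
    push_cast at hz
    linear_combination hz
  rcases mul_eq_zero.1 hfac with h | h
  · rw [eq_zero_of_pow_eq_zero h, norm_zero]
    exact hν0.le
  · exact (norm_eq_of_quadratic hν0.le hc h).le

/-! ### The polynomial statement -/

lemma exists_root_one_le_norm {M : ℕ} (hM : 2 ≤ M) {ν : ℝ} (hν : ν ∈ Set.Ioo (0 : ℝ) 1) {a : ℕ → ℝ}
    (ha : a (M - 1) ≠ -1) :
    ∃ θ ∈ Set.Icc (0 : ℝ) Real.pi, ∃ y : ℂ, 1 ≤ ‖y‖ ∧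
      (y - Complex.exp (Complex.I * θ)) * (y - Complex.exp (-(Complex.I * θ))) * y ^ (M - 2)
        + (y - 1 / (ν : ℂ)) * ∑ k ∈ Finset.range M, (a k : ℂ) * y ^ k = 0 := by
  obtain ⟨h0, h1⟩ := hν
  have hνC : (ν : ℂ) ≠ 0 := by exact_mod_cast h0.ne'
  by_contra! hne
  -- the reciprocal polynomial for `θ = π / 2`
  let D : ℂ → ℂ := fun w =>
    1 + w ^ 2 + (1 - w / ν) * ∑ k ∈ Finset.range M, (a k : ℂ) * w ^ (M - 1 - k)
  have hD : Differentiable ℂ D := by fun_prop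
  let μ : ℝ := 2 * ν / (1 + ν ^ 2)
  have hroot : √(1 - μ ^ 2) = (1 - ν ^ 2) / (1 + ν ^ 2) := by
    rw [Real.sqrt_eq_iff_mul_self_eq_of_pos (div_pos (by nlinarith) (by positivity))]
    simp only [μ]
    field_simp
    ring
  have hμ : μ ^ 2 ≤ 1 := by
    simp only [μ]
    rw [div_pow, div_le_one (by positivity)]
    nlinarith [sq_nonneg (1 - ν ^ 2)]
  have key := inv_joukowsky_lt_div_of_forall_ne hD (B := 2) (R := 1) (x := ν) (μ := μ) h0 h1
    hμ ?_ ?_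
  · have : μ / (1 + √(1 - μ ^ 2)) = ν / 1 := by
      rw [hroot]
      simp only [μ]
      field_simp
      ring
    linarith
  · intro c hc w hw heq
    by_cases hw0 : w = 0
    · -- at the origin, `D` is the leading coefficient `1 + a_{M-1}`
      subst hw0
      apply ha
      have hs : ∑ k ∈ Finset.range M, (a k : ℂ) * 0 ^ (M - 1 - k) = a (M - 1) := by
        rw [Finset.sum_eq_single_of_mem (M - 1) (Finset.mem_range.2 (by omega))]
        · simp
        · intro k hk hk'
          have := Finset.mem_range.1 hk
          rw [zero_pow (by omega), mul_zero]
      simp only [D, hs] at heq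
      have : (a (M - 1) : ℂ) = -1 := by
        simp at heq
        linear_combination heq
      exact_mod_cast this
    · refine hne (Real.arccos c) ⟨Real.arccos_nonneg c, Real.arccos_le_pi c⟩ w⁻¹ ?_ ?_
      · rw [norm_inv]
        exact (one_le_inv₀ (norm_pos_iff.2 hw0)).2 hw
      · have hcos : Complex.exp (Complex.I * Real.arccos c)
            + Complex.exp (-(Complex.I * Real.arccos c)) = 2 * c := by
          have h := Complex.two_cos (Real.arccos c : ℂ)
          rw [← Complex.ofReal_cos, Real.cos_arccos hc.1 hc.2] at h
          rw [h]
          congr 2 <;> ring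
        have hexp : Complex.exp (Complex.I * Real.arccos c)
            * Complex.exp (-(Complex.I * Real.arccos c)) = 1 := by
          rw [← Complex.exp_add, add_neg_cancel, Complex.exp_zero]
        have hp : ∀ k ∈ Finset.range M,
            (a k : ℂ) * w⁻¹ ^ k = (a k : ℂ) * w ^ (M - 1 - k) * w⁻¹ ^ (M - 1) := fun k hk => by
          have hk := Finset.mem_range.1 hk
          rw [show w⁻¹ ^ (M - 1) = w⁻¹ ^ k * w⁻¹ ^ (M - 1 - k) by
            rw [← pow_add]; congr 1; omega, inv_pow w (M - 1 - k)]
          field_simp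
        rw [Finset.sum_congr rfl hp, ← Finset.sum_mul]
        simp only [D] at heq
        set S := ∑ k ∈ Finset.range M, (a k : ℂ) * w ^ (M - 1 - k)
        rw [show M - 1 = M - 2 + 1 by omega, pow_succ]
        have hq : (w⁻¹ - Complex.exp (Complex.I * Real.arccos c))
            * (w⁻¹ - Complex.exp (-(Complex.I * Real.arccos c))) = w⁻¹ ^ 2 - 2 * c * w⁻¹ + 1 := by
          linear_combination (-w⁻¹) * hcos + hexp
        rw [hq]
        have hww : w * w⁻¹ = 1 := mul_inv_cancel₀ hw0
        have e : w⁻¹ ^ 2 - 2 * c * w⁻¹ + 1 + (w⁻¹ - 1 / ν) * (S * w⁻¹) = 0 := by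
          have : w⁻¹ ^ 2 * (1 + w ^ 2 + (1 - w / ν) * S - c * (2 : ℝ) * w) = 0 := by
            rw [heq]; ring
          rw [← this]
          push_cast
          field_simp
          ring
        linear_combination w⁻¹ ^ (M - 2) * e
  · simp only [D, μ]
    have : (1 + (ν : ℂ) ^ 2) ≠ 0 := by exact_mod_cast (by positivity : 1 + ν ^ 2 ≠ 0)
    push_cast
    rw [div_self hνC, sub_self, zero_mul, add_zero]
    field_simp

theorem theorem3 (M : ℕ) (hM : 2 ≤ M) (lo hi : ℝ) (hlo : 0 < lo) (hlohi : lo < hi) :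
    -- the maximum that defines the convergence speed guarantee is attained
    (∀ (α : ℝ) (β : ℕ → ℝ),
      IsGreatest (rootModuli M lo hi α β) (speedGuarantee M lo hi α β)) ∧
    -- it bounds the characteristic roots of all nonzero modes of the dynamics
    (∀ (N : ℕ) (A : EuclideanSpace ℝ (Fin N) →ₗ[ℝ] EuclideanSpace ℝ (Fin N))
      (b : EuclideanSpace ℝ (Fin N)),
      A.IsSymmetric →
      (∀ lam : ℝ, Module.End.HasEigenvalue A lam → lam ≠ 0 → lam ∈ Set.Icc lo hi) →
      ∀ (α : ℝ) (β : ℕ → ℝ) (x : ℤ → EuclideanSpace ℝ (Fin N)),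
        IsMemoryTrajectory M A b α β x →
        ∀ s : EuclideanSpace ℝ (Fin N), A s = b →
        ∀ (lam : ℝ) (v : EuclideanSpace ℝ (Fin N)),
          Module.End.HasEigenvector A lam v → lam ≠ 0 →
          (modalRecurrence M α β lam).IsSolution
              (fun n : ℕ => inner ℝ v (x ((n : ℤ) - ((M : ℤ) - 1)) - s)) ∧
            ∀ z : ℂ, IsModalRoot M α β lam z → ‖z‖ ≤ speedGuarantee M lo hi α β) ∧
    -- the single-slot tuning minimizes the guarantee over all real gains, with value `ν⋆`
    (∀ (α : ℝ) (β : ℕ → ℝ),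
      speedGuarantee M lo hi (alphaStar lo hi) (betaStar lo hi)
        ≤ speedGuarantee M lo hi α β) ∧
    speedGuarantee M lo hi (alphaStar lo hi) (betaStar lo hi) = nuStar lo hi ∧
    nuStar lo hi = √(-betaOneStar lo hi) ∧
    nuStar lo hi ∈ Set.Ioo (0 : ℝ) 1 ∧
    -- the equivalent statement about polynomials
    (∀ ν ∈ Set.Ioo (0 : ℝ) 1, ∀ a : ℕ → ℝ, a (M - 1) ≠ -1 →
      ∃ θ ∈ Set.Icc (0 : ℝ) Real.pi, ∃ y : ℂ, 1 ≤ ‖y‖ ∧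
        (y - Complex.exp (Complex.I * θ)) * (y - Complex.exp (-(Complex.I * θ))) * y ^ (M - 2)
          + (y - 1 / (ν : ℂ)) * ∑ k ∈ Finset.range M, (a k : ℂ) * y ^ k = 0) := by
  refine ⟨fun α β => isGreatest_speedGuarantee (by omega) hlohi.le α β, ?_, fun α β => ?_, ?_, ?_,
    nuStar_mem_Ioo hlo hlohi, fun ν hν a ha => exists_root_one_le_norm hM hν ha⟩
  · intro N A b hA hspec α β x hx s hs lam v hv hlam
    refine ⟨isSolution_mode (by omega) hA hx hs hv.apply_eq_smul, fun z hz => ?_⟩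
    exact (isGreatest_speedGuarantee (by omega) hlohi.le α β).2
      ⟨lam, hspec lam (Module.End.hasEigenvalue_of_hasEigenvector hv) hlam, z, hz, rfl⟩
  · exact (speedGuarantee_star_le hM hlo hlohi).trans
      (nuStar_le_speedGuarantee (by omega) hlo hlohi α β)
  · exact (speedGuarantee_star_le hM hlo hlohi).antisymm
      (nuStar_le_speedGuarantee (by omega) hlo hlohi _ _)
  · rw [betaOneStar, neg_neg]
    exact (Real.sqrt_sq (nuStar_mem_Ioo hlo hlohi).1.le).symm
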